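/- Let $T=(V,E)$ be a tree on $V=\{1,\dots,d\}$, and let $Q$ be a positive definite $d\times d$ matrix with $(Q^{-1})_{jk}\neq 0 \iff \{j,k\}\in E$ for all $j\neq k$, so that $\mathcal N(0,Q)$ is a zero-mean Gaussian graphical model on $T$. Let $\rho_{jk}=Q_{jk}/\sqrt{Q_{jj}Q_{kk}}$, and assume that $\alpha\le\rho_{jk}\le\beta$ for every edge $\{j,k\}\in E$, where $0<\alpha<\beta<1$. Let $x^{(1)},\dots,x^{(n)}$ be i.i.d. samples from $\mathcal N(0,Q)$, and let $u^{(i)}\in\{-1,+1\}^d$ be the vector of signs of the coordinates of $x^{(i)}$. For each pair $j\ne k$ put $$\hat\theta_{jk}=\frac1n\sum_{i=1}^n \mathbf 1\{u^{(i)}_j u^{(i)}_k=1\},\qquad \hat I_{jk}=1-H(\hat\theta_{jk}),\qquad H(\theta)=-\theta\log_2\theta-(1-\theta)\log_2(1-\theta).$$ Let $\widehat T$ be the tree returned by the Chow–Liu algorithm on the sign vectors, that is, by Kruskal's maximum-weight spanning tree algorithm on the complete graph on $V$ with edge weights $\hat I_{jk}$: the pairs are sorted by descending weight (ties in any order), scanned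 in that order, and each is added unless it creates a cycle. Then $$\Pr(\widehat T\neq T)\le d^3\exp\!\left(-\tfrac12\, n\, h(\alpha,\beta)^2\right),\qquad h(\alpha,\beta)=\frac1\pi\left(\arcsin\alpha-\arcsin(\alpha\beta)\right).$$ The same bound holds if Kruskal's algorithm is run with the edge weights $\hat\theta_{jk}$ in place of $\hat I_{jk}$. -/

import Mathlib

open MeasureTheory ProbabilityTheory

namespace SignTree

/-- The centred Gaussian law with covariance matrix `Q` is a Gaussian graphical model on the tree
`T`: the covariance is nondegenerate, and the off-diagonal support of the precision matrix `Q⁻¹`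
is exactly the edge set of `T`. -/
structure IsTreeGGM {d : ℕ} (T : SimpleGraph (Fin d)) (Q : Matrix (Fin d) (Fin d) ℝ) : Prop where
  isTree : T.IsTree
  posDef : Q.PosDef
  precision_ne_zero_iff : ∀ j k : Fin d, j ≠ k → (Q⁻¹ j k ≠ 0 ↔ T.Adj j k)

/-- The correlation coefficient of coordinates `j` and `k` under the covariance matrix `Q`. -/
noncomputable def corr {d : ℕ} (Q : Matrix (Fin d) (Fin d) ℝ) (j k : Fin d) : ℝ :=
  Q j k / (√(Q j j) * √(Q k k))

/-- The sign vector in `{-1, +1}^d` (the value at `0` is an irrelevant convention). -/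
noncomputable def signVec {d : ℕ} (x : EuclideanSpace ℝ (Fin d)) (j : Fin d) : ℤ :=
  if 0 ≤ x j then 1 else -1

/-- The fraction of the `n` sign vectors whose two coordinates in the pair `e` agree. -/
noncomputable def thetaHat {d n : ℕ} (u : Fin n → Fin d → ℤ) (e : Sym2 (Fin d)) : ℝ :=
  Sym2.lift ⟨fun j k => (1 / (n : ℝ)) * ∑ i : Fin n, if u i j * u i k = 1 then (1 : ℝ) else 0,
    fun j k => by simp only [mul_comm]⟩ e

/-- The estimated mutual information, in bits, of the two signs in the pair `e`:
one minus the binary entropy at the fraction of agreements. -/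
noncomputable def mutualInfoHat {d n : ℕ} (u : Fin n → Fin d → ℤ) (e : Sym2 (Fin d)) : ℝ :=
  1 - Real.binEntropy (thetaHat u e) / Real.log 2

open Classical in
/-- One step of Kruskal's algorithm: add `e` to the current forest unless this creates a cycle. -/
noncomputable def kruskalStep {V : Type*} (F : SimpleGraph V) (e : Sym2 V) : SimpleGraph V :=
  if (F ⊔ SimpleGraph.fromEdgeSet {e}).IsAcyclic then F ⊔ SimpleGraph.fromEdgeSet {e} else F

/-- Kruskal's algorithm: scan the list of pairs, starting from the empty forest. (Once the forest
is a spanning tree, every further pair is rejected, so stopping there gives the same output.) -/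
noncomputable def kruskal {V : Type*} (l : List (Sym2 V)) : SimpleGraph V :=
  l.foldl kruskalStep ⊥

/-- `l` lists every pair of distinct vertices exactly once, by descending weight. Ties may come in
any order. -/
structure IsDescendingOrder {V : Type*} (w : Sym2 V → ℝ) (l : List (Sym2 V)) : Prop where
  nodup : l.Nodup
  mem_iff : ∀ e : Sym2 V, e ∈ l ↔ ¬ e.IsDiag
  sorted : l.Pairwise (fun e e' => w e' ≤ w e)

/-- `G` is an output of Kruskal's algorithm for a maximum-weight spanning tree of the complete
graph with edge weights `w`, for some way of breaking ties. -/
def IsKruskalOutput {V : Type*} (w : Sym2 V → ℝ) (G : SimpleGraph V) : Prop :=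
  ∃ l : List (Sym2 V), IsDescendingOrder w l ∧ kruskal l = G

/-- Kruskal's algorithm always has an output. -/
theorem exists_isKruskalOutput {V : Type*} [Finite V] (w : Sym2 V → ℝ) :
    ∃ G : SimpleGraph V, IsKruskalOutput w G := by
  classical
  have := Fintype.ofFinite V
  let l0 : List (Sym2 V) := (Finset.univ.filter fun e : Sym2 V => ¬ e.IsDiag).toList
  let l : List (Sym2 V) := l0.insertionSort (fun e e' => w e' ≤ w e)
  have hp : l.Perm l0 := List.perm_insertionSort _ _
  have : Std.Total (fun e e' : Sym2 V => w e' ≤ w e) := ⟨fun a b => le_total _ _⟩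
  have : IsTrans (Sym2 V) (fun e e' => w e' ≤ w e) := ⟨fun a b c h h' => h'.trans h⟩
  refine ⟨kruskal l, l, ⟨?_, ?_, ?_⟩, rfl⟩
  · exact hp.nodup_iff.2 (Finset.nodup_toList _)
  · intro e
    rw [hp.mem_iff]
    simp [l0]
  · exact List.pairwise_insertionSort _ _

/-- `h(α, β) = (arcsin α - arcsin (αβ)) / π`. -/
noncomputable def gap (α β : ℝ) : ℝ :=
  (1 / Real.pi) * (Real.arcsin α - Real.arcsin (α * β))

end SignTree

/-!
Kruskal's algorithm returns `T` as soon as, for every non-adjacent pair `f`, each edge `e` on the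
`T`-path joining the ends of `f` is strictly heavier than `f`: edges of `T` are never rejected, and
when `f` is scanned its whole path has already been accepted
(`SignTree.IsKruskalOutput.eq_of_forall_path_lt`).

In a Gaussian model on a tree, correlations multiply along paths, because the precision matrix
splits at each separating vertex (`SignTree.IsTreeGGM.corr_eq_mul`). Hence `0 < ρ_f ≤ β ρ_e`.
By Sheppard's formula (`SignTree.multivariateGaussian_sign_agree`) two coordinates with correlation
`ρ` have equal signs with probability `1 / 2 + arcsin ρ / π`; it is proved by reducing to two
independent standard Gaussians, whose joint law gives a cone a mass proportional to its angle.
Monotonicity of `x ↦ arcsin x - arcsin (β x)` then shows that the expectations of `θ_e - θ_f` and of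
`θ_e + θ_f - 1` are both at least `gap α β`.

By Hoeffding's inequality each of these two variables is nonpositive with probability at most
`exp (-n (gap α β)² / 2)`, and when both are positive, `e` outweighs `f` under the weights `θ`
and also under the weights `1 - H(θ)`, since then `θ_e` is further from `1 / 2` than `θ_f`. There
are at most `(d - 1) * d.choose 2` pairs `(e, f)` and two events for each, so the union bound
gives the factor `d ^ 3`.
-/

namespace SignTree

/-! ### Kruskal's algorithm -/

/-- The loop invariant of Kruskal's algorithm: if each edge on the `T`-path joining the ends of a
non-edge of `T` weighs strictly more than that non-edge, then after a prefix `l₁` of the list the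
current forest consists of exactly the edges of `T` in `l₁`. -/
theorem kruskal_foldl_eq {V : Type*} {w : Sym2 V → ℝ} {T : SimpleGraph V} (hT : T.IsTree)
    (hw : ∀ (s t : V) (p : T.Walk s t), p.IsPath → s ≠ t → ¬ T.Adj s t →
      ∀ e ∈ p.edges, w s(s, t) < w e)
    (l : List (Sym2 V)) (hl : IsDescendingOrder w l) (l₁ l₂ : List (Sym2 V)) (h : l = l₁ ++ l₂) :
    ∀ e, e ∈ (l₁.foldl kruskalStep ⊥ : SimpleGraph V).edgeSet ↔ e ∈ l₁ ∧ e ∈ T.edgeSet := by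
  induction l₁ using List.reverseRecOn generalizing l₂ with
  | nil => simp
  | append_singleton l₁ f ih =>
    have hdec : l = l₁ ++ f :: l₂ := by simpa using h
    specialize ih _ hdec
    rw [List.foldl_append, List.foldl_cons, List.foldl_nil]
    set F := l₁.foldl kruskalStep (⊥ : SimpleGraph V) with hF
    have hFT : F ≤ T := by
      rw [← SimpleGraph.edgeSet_subset_edgeSet]
      exact fun e he => ((ih e).1 he).2
    have hfl : ¬ f.IsDiag := (hl.mem_iff f).1 (by simp [hdec])
    by_cases hf : f ∈ T.edgeSet
    · have hle : F ⊔ SimpleGraph.fromEdgeSet {f} ≤ T := by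
        refine sup_le hFT ?_
        rw [← SimpleGraph.fromEdgeSet_edgeSet T]
        exact SimpleGraph.fromEdgeSet_mono (by simpa using hf)
      have hac : (F ⊔ SimpleGraph.fromEdgeSet {f}).IsAcyclic := hT.isAcyclic.anti hle
      intro e
      rw [kruskalStep, if_pos hac, SimpleGraph.edgeSet_sup, SimpleGraph.edgeSet_fromEdgeSet,
        Set.mem_union, ih e, List.mem_append, List.mem_singleton]
      simp only [Set.mem_sdiff, Set.mem_singleton_iff]
      constructor
      · rintro (h | ⟨rfl, -⟩)
        · exact ⟨Or.inl h.1, h.2⟩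
        · exact ⟨Or.inr rfl, hf⟩
      · rintro ⟨h | rfl, h'⟩
        · exact Or.inl ⟨h, h'⟩
        · exact Or.inr ⟨rfl, hfl⟩
    -- All path edges precede the non-edge `f` in the list, so they are already in `F`.
    · have hac : ¬ (F ⊔ SimpleGraph.fromEdgeSet {f}).IsAcyclic := by
        induction f using Sym2.ind with
        | _ s t =>
        have hst : s ≠ t := by simpa using hfl
        have hadj : ¬ T.Adj s t := by simpa using hf
        obtain ⟨p, hp, -⟩ := hT.existsUnique_path s t
        have hpF : ∀ e ∈ p.edges, e ∈ F.edgeSet := by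
          intro e he
          have heT := p.edges_subset_edgeSet he
          refine (ih e).2 ⟨?_, heT⟩
          have hlt := hw s t p hp hst hadj e he
          have hmem : e ∈ l := (hl.mem_iff e).2 (T.not_isDiag_of_mem_edgeSet heT)
          rw [hdec, List.mem_append, List.mem_cons] at hmem
          have hsort := hl.sorted
          rw [hdec, List.pairwise_append, List.pairwise_cons] at hsort
          rcases hmem with h | rfl | h
          · exact h
          · exact absurd hlt (lt_irrefl _)
          · exact absurd hlt (not_lt.2 (hsort.2.1.1 e h))
        intro hcon
        have := (SimpleGraph.isAcyclic_sup_fromEdgeSet_iff (G := F) (u := s) (v := t)).1 hcon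
        rcases this.2 ⟨p.transfer F hpF⟩ with h | h
        · exact hst h
        · exact hadj (hFT h)
      intro e
      rw [kruskalStep, if_neg hac, ih e, List.mem_append, List.mem_singleton]
      constructor
      · exact fun h => ⟨Or.inl h.1, h.2⟩
      · rintro ⟨h | rfl, h'⟩
        · exact ⟨h, h'⟩
        · exact absurd h' hf

theorem IsKruskalOutput.eq_of_forall_path_lt {V : Type*} {w : Sym2 V → ℝ} {T G : SimpleGraph V}
    (hT : T.IsTree)
    (hw : ∀ (s t : V) (p : T.Walk s t), p.IsPath → s ≠ t → ¬ T.Adj s t →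
      ∀ e ∈ p.edges, w s(s, t) < w e)
    (hG : IsKruskalOutput w G) : G = T := by
  obtain ⟨l, hl, rfl⟩ := hG
  rw [← SimpleGraph.edgeSet_inj]
  ext e
  rw [kruskal, kruskal_foldl_eq hT hw l hl l [] (by simp) e]
  exact ⟨fun h => h.2, fun h => ⟨(hl.mem_iff e).2 (T.not_isDiag_of_mem_edgeSet h), h⟩⟩

/-! ### Correlations in a tree model -/

open Matrix in
/-- The conditional independence of `s` and `t` given a separating vertex `k`, as an identity for
the covariance matrix. Here `S` plays the part of a union of components of the graph of `Q⁻¹` with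
`k` removed, on the side away from `t`. -/
theorem _root_.Matrix.PosDef.mul_apply_eq_of_separator {ι : Type*} [Fintype ι] [DecidableEq ι]
    {Q : Matrix ι ι ℝ} (hQ : Q.PosDef) {S : Set ι} {k t : ι} (hk : k ∉ S) (ht : t ∉ S)
    (hS : ∀ i ∈ S, ∀ j ∉ S, j ≠ k → Q⁻¹ i j = 0) {s : ι} (hs : s ∈ S) :
    Q s t * Q k k = Q s k * Q k t := by
  classical
  have hdet : IsUnit Q.det := (Matrix.isUnit_iff_isUnit_det Q).1 hQ.isUnit
  -- The vector `y = Q c` vanishes at `k` and `Q⁻¹ y = c` is supported on `{k, t}`, so the part `z`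
  -- of `y` supported on `S` satisfies `zᵀ Q⁻¹ z = 0`, hence `z = 0`.
  set c : ι → ℝ := Q k k • Pi.single t 1 - Q k t • Pi.single k 1 with hc
  set y : ι → ℝ := Q *ᵥ c with hy
  have hyv : ∀ i, y i = Q i t * Q k k - Q i k * Q k t := by
    intro i
    simp only [hy, hc, Matrix.mulVec_sub, Matrix.mulVec_smul, Matrix.mulVec_single_one]
    simp [mul_comm]
  have hKy : Q⁻¹ *ᵥ y = c := by
    rw [hy, Matrix.mulVec_mulVec, Matrix.nonsing_inv_mul _ hdet, Matrix.one_mulVec]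
  have hyk : y k = 0 := by rw [hyv]; ring
  set z : ι → ℝ := fun i => if i ∈ S then y i else 0 with hz
  have hKz : ∀ i ∈ S, (Q⁻¹ *ᵥ z) i = 0 := by
    intro i hi
    have hci : c i = 0 := by
      have h1 : i ≠ t := fun h => ht (h ▸ hi)
      have h2 : i ≠ k := fun h => hk (h ▸ hi)
      simp [hc, h1, h2]
    rw [← hci, ← hKy]
    simp only [Matrix.mulVec, dotProduct]
    refine Finset.sum_congr rfl fun j _ => ?_
    by_cases hj : j ∈ S
    · simp [hz, hj]
    · by_cases hjk : j = k
      · simp [hjk, hyk, hz, hk]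
      · simp [hS i hi j hj hjk]
  have hz0 : z = 0 := by
    by_contra hne
    have hpos := hQ.inv.dotProduct_mulVec_pos hne
    have : star z ⬝ᵥ (Q⁻¹ *ᵥ z) = 0 := by
      rw [dotProduct]
      refine Finset.sum_eq_zero fun i _ => ?_
      by_cases hi : i ∈ S
      · rw [hKz i hi, mul_zero]
      · simp [hz, hi]
    exact hpos.ne' this
  have : z s = 0 := by rw [hz0]; rfl
  simp only [hz, hs, if_true] at this
  rw [hyv] at this
  linarith

theorem corr_comm {d : ℕ} {Q : Matrix (Fin d) (Fin d) ℝ} (hQ : Q.PosDef) (j k : Fin d) :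
    corr Q j k = corr Q k j := by
  have : Q j k = Q k j := by simpa using (hQ.isHermitian.apply j k).symm
  rw [corr, corr, this, mul_comm (√(Q j j))]

theorem corr_self {d : ℕ} {Q : Matrix (Fin d) (Fin d) ℝ} (hQ : Q.PosDef) (j : Fin d) :
    corr Q j j = 1 := by
  have := hQ.diag_pos (i := j)
  rw [corr, Real.mul_self_sqrt this.le, div_self this.ne']

/-- In a tree model, correlations multiply across every vertex `r` that separates `s` from `t`. -/
theorem IsTreeGGM.corr_eq_mul {d : ℕ} {T : SimpleGraph (Fin d)} {Q : Matrix (Fin d) (Fin d) ℝ}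
    (h : IsTreeGGM T Q) {s t r : Fin d} (hr : ∀ p : T.Walk s t, r ∈ p.support) :
    corr Q s t = corr Q s r * corr Q r t := by
  rcases eq_or_ne s r with rfl | hsr
  · rw [corr_self h.posDef, one_mul]
  rcases eq_or_ne t r with rfl | htr
  · rw [corr_self h.posDef, mul_one]
  -- `S` is the set of vertices other than `r` that `r` separates from `t`.
  have key := h.posDef.mul_apply_eq_of_separator (k := r) (t := t) (s := s)
    (S := {x | x ≠ r ∧ ∀ p : T.Walk x t, r ∈ p.support}) (by simp)
    (fun hmem => htr (by simpa [eq_comm] using hmem.2 .nil)) (by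
      rintro i ⟨hir, hi⟩ j hj hjr
      simp only [Set.mem_ofPred_eq, not_and, not_forall] at hj
      obtain ⟨p, hp⟩ := hj hjr
      have hij : i ≠ j := by rintro rfl; exact hp (hi p)
      by_contra hne
      have hadj := (h.precision_ne_zero_iff i j hij).1 hne
      have := hi (.cons hadj p)
      rw [SimpleGraph.Walk.support_cons, List.mem_cons] at this
      exact this.elim (fun h => hir h.symm) hp) ⟨hsr, hr⟩
  have h0 : ∀ i, 0 < Q i i := fun i => h.posDef.diag_pos
  have hs := Real.sqrt_pos.2 (h0 s)
  have ht := Real.sqrt_pos.2 (h0 t)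
  have hrr := Real.sqrt_pos.2 (h0 r)
  have hr2 : √(Q r r) * √(Q r r) = Q r r := Real.mul_self_sqrt (h0 r).le
  unfold corr
  rw [div_mul_div_comm, div_eq_div_iff (by positivity) (by positivity), ← key]
  linear_combination (Q s t * √(Q s s) * √(Q t t)) * hr2

theorem IsTreeGGM.corr_eq_mul_of_cons {d : ℕ} {T : SimpleGraph (Fin d)}
    {Q : Matrix (Fin d) (Fin d) ℝ} (h : IsTreeGGM T Q) {s t r : Fin d} (hsr : T.Adj s r)
    (p : T.Walk r t) (hp : (SimpleGraph.Walk.cons hsr p).IsPath) :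
    corr Q s t = corr Q s r * corr Q r t := by
  refine h.corr_eq_mul fun q => ?_
  -- Every walk from `s` to `t` contains the vertices of the unique path.
  have := congrArg Subtype.val ((h.isTree.isAcyclic.subsingleton_path _ _).elim q.toPath ⟨_, hp⟩)
  refine q.support_bypass_subset_support ?_
  have h2 : q.bypass = SimpleGraph.Walk.cons hsr p := this
  rw [h2]
  simp

/-- The correlation of two vertices is the product of the edge correlations along the path between
them, so it lies in `(0, 1]`, and it is at most `β` unless the path is trivial. -/
theorem IsTreeGGM.corr_bounds_of_isPath {d : ℕ} {T : SimpleGraph (Fin d)}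
    {Q : Matrix (Fin d) (Fin d) ℝ} (h : IsTreeGGM T Q) {α β : ℝ} (hα : 0 < α) (hβ : β < 1)
    (hcorr : ∀ j k, T.Adj j k → α ≤ corr Q j k ∧ corr Q j k ≤ β) {s t : Fin d} (p : T.Walk s t)
    (hp : p.IsPath) :
    0 < corr Q s t ∧ corr Q s t ≤ 1 ∧ (1 ≤ p.length → corr Q s t ≤ β) := by
  induction p with
  | nil => simp [corr_self h.posDef]
  | @cons u v w hadj p ih =>
    obtain ⟨h0, h1, -⟩ := ih hp.of_cons
    rw [h.corr_eq_mul_of_cons hadj p hp]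
    obtain ⟨ha, hb⟩ := hcorr _ _ hadj
    have hpos := hα.trans_le ha
    have hle : corr Q u v * corr Q v w ≤ β := (mul_le_of_le_one_right hpos.le h1).trans hb
    exact ⟨mul_pos hpos h0, hle.trans hβ.le, fun _ => hle⟩

/-- The correlation along a path is at most that of each of its edges `{j, k}`, with an extra factor
`β` when the path has a second edge. -/
theorem IsTreeGGM.corr_le_of_mem_edges {d : ℕ} {T : SimpleGraph (Fin d)}
    {Q : Matrix (Fin d) (Fin d) ℝ} (h : IsTreeGGM T Q) {α β : ℝ} (hα : 0 < α) (hβ : β < 1)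
    (hcorr : ∀ j k, T.Adj j k → α ≤ corr Q j k ∧ corr Q j k ≤ β) {s t : Fin d} (p : T.Walk s t)
    (hp : p.IsPath) {j k : Fin d} (he : s(j, k) ∈ p.edges) :
    corr Q s t ≤ corr Q j k ∧ (2 ≤ p.length → corr Q s t ≤ β * corr Q j k) := by
  induction p with
  | nil => simp at he
  | @cons u v w hadj p ih =>
    obtain ⟨h0, h1, hb⟩ := h.corr_bounds_of_isPath hα hβ hcorr p hp.of_cons
    rw [h.corr_eq_mul_of_cons hadj p hp]
    obtain ⟨hau, hbu⟩ := hcorr _ _ hadj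
    have hpos := hα.trans_le hau
    rw [SimpleGraph.Walk.edges_cons, List.mem_cons] at he
    rcases he with he | he
    · have : corr Q j k = corr Q u v := by
        rcases Sym2.eq_iff.1 he with ⟨rfl, rfl⟩ | ⟨rfl, rfl⟩
        · rfl
        · exact corr_comm h.posDef _ _
      rw [this]
      refine ⟨mul_le_of_le_one_right hpos.le h1, fun hlen => ?_⟩
      rw [mul_comm β]
      exact mul_le_mul_of_nonneg_left (hb (by simpa using hlen)) hpos.le
    · have ih1 := (ih hp.of_cons he).1
      have hle : corr Q u v * corr Q v w ≤ β * corr Q j k :=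
        mul_le_mul hbu ih1 h0.le (hpos.le.trans hbu)
      refine ⟨hle.trans ?_, fun _ => hle⟩
      exact mul_le_of_le_one_left (h0.le.trans ih1) hβ.le

/-! ### Sheppard's orthant formula -/
theorem gaussianPDF_zero_one_mul_polar (r θ : ℝ) :
    gaussianPDF 0 1 (r * Real.cos θ) * gaussianPDF 0 1 (r * Real.sin θ) =
      ENNReal.ofReal ((2 * Real.pi)⁻¹ * Real.exp (-r ^ 2 / 2)) := by
  rw [gaussianPDF, gaussianPDF, ← ENNReal.ofReal_mul (gaussianPDFReal_nonneg _ _ _)]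
  congr 1
  simp only [gaussianPDFReal, NNReal.coe_one, mul_one, sub_zero]
  have h2 : (√(2 * Real.pi))⁻¹ * (√(2 * Real.pi))⁻¹ = (2 * Real.pi)⁻¹ := by
    rw [← mul_inv, Real.mul_self_sqrt (by positivity)]
  rw [mul_mul_mul_comm, h2, ← Real.exp_add]
  congr 2
  linear_combination (-r ^ 2 / 2) * Real.sin_sq_add_cos_sq θ

/-- The standard Gaussian measure of a cone in the plane, in polar coordinates: a radial constant
times the length of the set of angles. -/
theorem gaussianReal_prod_cone (A : Set (ℝ × ℝ)) (hA : MeasurableSet A)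
    (hcone : ∀ r : ℝ, 0 < r → ∀ x y : ℝ, (r * x, r * y) ∈ A ↔ (x, y) ∈ A) :
    ((gaussianReal 0 1).prod (gaussianReal 0 1)) A =
      (∫⁻ r in Set.Ioi (0 : ℝ), ENNReal.ofReal r *
        ENNReal.ofReal ((2 * Real.pi)⁻¹ * Real.exp (-r ^ 2 / 2))) *
      volume (Set.Ioo (-Real.pi) Real.pi ∩ {θ | (Real.cos θ, Real.sin θ) ∈ A}) := by
  have hB : MeasurableSet {θ : ℝ | (Real.cos θ, Real.sin θ) ∈ A} :=
    (Real.measurable_cos.prodMk Real.measurable_sin) hA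
  rw [gaussianReal_of_var_ne_zero _ one_ne_zero,
    prod_withDensity (measurable_gaussianPDF _ _) (measurable_gaussianPDF _ _),
    withDensity_apply _ hA, ← lintegral_indicator hA, ← Measure.volume_eq_prod,
    ← lintegral_comp_polarCoord_symm, polarCoord_target, Measure.volume_eq_prod,
    ← Measure.prod_restrict]
  have hvol : volume (Set.Ioo (-Real.pi) Real.pi ∩ {θ | (Real.cos θ, Real.sin θ) ∈ A}) =
      ∫⁻ θ in Set.Ioo (-Real.pi) Real.pi,
        {θ : ℝ | (Real.cos θ, Real.sin θ) ∈ A}.indicator 1 θ := by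
    rw [lintegral_indicator_one hB, Measure.restrict_apply hB, Set.inter_comm]
  rw [hvol, ← lintegral_prod_mul (by fun_prop) ((measurable_one.indicator hB).aemeasurable),
    Measure.prod_restrict]
  refine setLIntegral_congr_fun (measurableSet_Ioi.prod measurableSet_Ioo) fun p hp => ?_
  classical
  obtain ⟨r, θ⟩ := p
  have hr : 0 < r := hp.1
  simp only [polarCoord_symm_apply, smul_eq_mul, Set.indicator_apply, hcone r hr,
    gaussianPDF_zero_one_mul_polar, Set.mem_ofPred_eq, Pi.one_apply]
  split_ifs <;> simp

/-- The radial constant is `1 / (2π)`, since the whole plane is a cone of measure one. -/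
theorem gaussianReal_prod_cone_real (A : Set (ℝ × ℝ)) (hA : MeasurableSet A)
    (hcone : ∀ r : ℝ, 0 < r → ∀ x y : ℝ, (r * x, r * y) ∈ A ↔ (x, y) ∈ A) :
    ((gaussianReal 0 1).prod (gaussianReal 0 1)).real A =
      volume.real (Set.Ioo (-Real.pi) Real.pi ∩ {θ | (Real.cos θ, Real.sin θ) ∈ A}) /
        (2 * Real.pi) := by
  have h := gaussianReal_prod_cone A hA hcone
  have h1 := gaussianReal_prod_cone Set.univ .univ (by simp)
  rw [measure_univ] at h1
  have h1 := congrArg ENNReal.toReal h1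
  have h := congrArg ENNReal.toReal h
  simp only [Set.mem_univ, Set.ofPred_true, Set.inter_univ, Real.volume_Ioo, ENNReal.toReal_mul,
    ENNReal.toReal_one, ENNReal.toReal_ofReal (show 0 ≤ Real.pi - -Real.pi by
      linarith [Real.pi_pos])] at h1 h
  rw [Measure.real, h, eq_div_iff (by positivity), Measure.real]
  linear_combination (-(volume (Set.Ioo (-Real.pi) Real.pi ∩
    {θ | (Real.cos θ, Real.sin θ) ∈ A})).toReal) * h1

/-- The angles at which the signs of `cos θ` and `sin (φ + θ)` agree; both are negative on the two
outer intervals and nonnegative on the middle one. -/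
theorem setOf_cos_sin_sign_agree {φ : ℝ} (h0 : 0 ≤ φ) (h1 : φ < Real.pi / 2) :
    Set.Ioo (-Real.pi) Real.pi ∩
      {θ | 0 ≤ Real.cos θ ↔ 0 ≤ Real.sin φ * Real.cos θ + Real.cos φ * Real.sin θ} =
    Set.Ioo (-Real.pi) (-(Real.pi / 2)) ∪ (Set.Icc (-φ) (Real.pi / 2) ∪
      Set.Ioo (Real.pi - φ) Real.pi) := by
  have hpi := Real.pi_pos
  ext θ
  simp only [Set.mem_inter_iff, Set.mem_ofPred_eq, ← Real.sin_add, Set.mem_union, Set.mem_Ioo,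
    Set.mem_Icc]
  constructor
  · rintro ⟨⟨ha, hb⟩, h⟩
    rcases lt_or_ge θ (-(Real.pi / 2)) with h2 | h2
    · exact Or.inl ⟨ha, h2⟩
    rcases le_or_gt θ (Real.pi / 2) with h3 | h3
    · refine Or.inr (Or.inl ⟨?_, h3⟩)
      have := h.1 (Real.cos_nonneg_of_mem_Icc ⟨h2, h3⟩)
      by_contra! h4
      exact absurd this (not_le.2 (Real.sin_neg_of_neg_of_neg_pi_lt (by linarith) (by linarith)))
    · refine Or.inr (Or.inr ⟨?_, hb⟩)
      have hc : Real.cos θ < 0 := Real.cos_neg_of_pi_div_two_lt_of_lt h3 (by linarith)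
      by_contra! h4
      exact absurd (h.2 (Real.sin_nonneg_of_nonneg_of_le_pi (by linarith) (by linarith)))
        (not_le.2 hc)
  · rintro (⟨ha, hb⟩ | ⟨ha, hb⟩ | ⟨ha, hb⟩)
    · refine ⟨⟨ha, by linarith⟩, ?_⟩
      have hc : Real.cos θ < 0 := by
        rw [← Real.cos_neg]
        exact Real.cos_neg_of_pi_div_two_lt_of_lt (by linarith) (by linarith)
      have hs := Real.sin_neg_of_neg_of_neg_pi_lt (x := φ + θ) (by linarith) (by linarith)
      exact iff_of_false hc.not_ge hs.not_ge
    · refine ⟨⟨by linarith, by linarith⟩, ?_⟩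
      exact iff_of_true (Real.cos_nonneg_of_mem_Icc ⟨by linarith, hb⟩)
        (Real.sin_nonneg_of_nonneg_of_le_pi (by linarith) (by linarith))
    · refine ⟨⟨by linarith, hb⟩, ?_⟩
      have hc : Real.cos θ < 0 := Real.cos_neg_of_pi_div_two_lt_of_lt (by linarith) (by linarith)
      have hs : Real.sin (φ + θ) < 0 := by
        rw [← Real.sin_sub_two_pi]
        exact Real.sin_neg_of_neg_of_neg_pi_lt (by linarith) (by linarith)
      exact iff_of_false hc.not_ge hs.not_ge

theorem volume_real_sign_agree {φ : ℝ} (h0 : 0 ≤ φ) (h1 : φ < Real.pi / 2) :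
    volume.real (Set.Ioo (-Real.pi) Real.pi ∩
      {θ | 0 ≤ Real.cos θ ↔ 0 ≤ Real.sin φ * Real.cos θ + Real.cos φ * Real.sin θ}) =
    Real.pi + 2 * φ := by
  have hpi := Real.pi_pos
  rw [setOf_cos_sin_sign_agree h0 h1,
    measureReal_union _ (measurableSet_Icc.union measurableSet_Ioo) (by simp) (by simp),
    measureReal_union _ measurableSet_Ioo (by simp) (by simp)]
  · rw [Real.volume_real_Ioo_of_le (by linarith), Real.volume_real_Icc_of_le (by linarith),
      Real.volume_real_Ioo_of_le (by linarith)]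
    ring
  · rw [Set.disjoint_left]
    rintro x ⟨-, hx⟩ ⟨hx', -⟩
    linarith
  · rw [Set.disjoint_left]
    rintro x ⟨-, hx⟩ (⟨hx', -⟩ | ⟨hx', -⟩) <;> linarith

theorem measurableSet_linear_sign_agree (ρ : ℝ) :
    MeasurableSet {z : ℝ × ℝ | 0 ≤ z.1 ↔ 0 ≤ ρ * z.1 + √(1 - ρ ^ 2) * z.2} := by
  have ha : MeasurableSet {z : ℝ × ℝ | 0 ≤ z.1} := measurableSet_le (by fun_prop) (by fun_prop)
  have hb : MeasurableSet {z : ℝ × ℝ | 0 ≤ ρ * z.1 + √(1 - ρ ^ 2) * z.2} :=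
    measurableSet_le (by fun_prop) (by fun_prop)
  exact ha.iff hb

/-- Sheppard's formula for a pair `(Z₁, ρ Z₁ + √(1 - ρ²) Z₂)` with `Z₁, Z₂` independent standard
Gaussians and `0 ≤ ρ < 1`. -/
theorem gaussianReal_prod_sign_agree {ρ : ℝ} (h0 : 0 ≤ ρ) (h1 : ρ < 1) :
    ((gaussianReal 0 1).prod (gaussianReal 0 1)).real
      {z | 0 ≤ z.1 ↔ 0 ≤ ρ * z.1 + √(1 - ρ ^ 2) * z.2} = 1 / 2 + Real.arcsin ρ / Real.pi := by
  have hpi := Real.pi_pos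
  rw [gaussianReal_prod_cone_real _ (measurableSet_linear_sign_agree ρ)]
  · have := volume_real_sign_agree (Real.arcsin_nonneg.2 h0) (Real.arcsin_lt_pi_div_two.2 h1)
    rw [Real.sin_arcsin (by linarith) h1.le, Real.cos_arcsin] at this
    simp only [Set.mem_ofPred_eq]
    rw [this]
    field_simp
  · intro r hr x y
    have e : ρ * (r * x) + √(1 - ρ ^ 2) * (r * y) = r * (ρ * x + √(1 - ρ ^ 2) * y) := by ring
    simp only [Set.mem_ofPred_eq, e, mul_nonneg_iff_of_pos_left hr]

/-! ### Sign agreement of Gaussian coordinates -/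
theorem covariance_linear_multivariateGaussian {ι : Type*} [Fintype ι] [DecidableEq ι]
    {Q : Matrix ι ι ℝ} (hQ : Q.PosSemidef) (s t : ι) (a b a' b' : ℝ) :
    cov[fun x => a * x s + b * x t, fun x => a' * x s + b' * x t; multivariateGaussian 0 Q] =
      a * a' * Q s s + a * b' * Q s t + b * a' * Q t s + b * b' * Q t t := by
  have hm (c : ℝ) (i : ι) : MemLp (fun x : EuclideanSpace ℝ ι => c * x i) 2
      (multivariateGaussian 0 Q) := by
    have : HasGaussianLaw (fun x : EuclideanSpace ℝ ι => (c • EuclideanSpace.proj (𝕜 := ℝ) i :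
        EuclideanSpace ℝ ι →L[ℝ] ℝ) x) (multivariateGaussian 0 Q) :=
      IsGaussian.hasGaussianLaw_id.map_fun _
    exact this.memLp_two
  have hadd (c c' : ℝ) : MemLp (fun x : EuclideanSpace ℝ ι => c * x s + c' * x t) 2
      (multivariateGaussian 0 Q) := (hm c s).add (hm c' t)
  have hright (c : ℝ) (i : ι) : cov[fun x => c * x i, fun x => a' * x s + b' * x t;
      multivariateGaussian 0 Q] =
        cov[fun x => c * x i, fun x => a' * x s; multivariateGaussian 0 Q] +
        cov[fun x => c * x i, fun x => b' * x t; multivariateGaussian 0 Q] :=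
    covariance_add_right (hm c i) (hm a' s) (hm b' t)
  refine (covariance_add_left (hm a s) (hm b t) (hadd a' b')).trans ?_
  rw [hright, hright]
  simp only [covariance_const_mul_left, covariance_const_mul_right,
    covariance_eval_multivariateGaussian hQ]
  ring

/-- Two linear combinations of coordinates `s` and `t` with unit variances and zero covariance are
independent standard Gaussians. -/
theorem map_multivariateGaussian_eq_prod {ι : Type*} [Fintype ι] [DecidableEq ι]
    {Q : Matrix ι ι ℝ} (hQ : Q.PosSemidef) (s t : ι) {a b a' b' : ℝ}
    (h₁ : a * a * Q s s + a * b * Q s t + b * a * Q t s + b * b * Q t t = 1)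
    (h₂ : a' * a' * Q s s + a' * b' * Q s t + b' * a' * Q t s + b' * b' * Q t t = 1)
    (h₁₂ : a * a' * Q s s + a * b' * Q s t + b * a' * Q t s + b * b' * Q t t = 0) :
    (multivariateGaussian 0 Q).map (fun x => (a * x s + b * x t, a' * x s + b' * x t)) =
      (gaussianReal 0 1).prod (gaussianReal 0 1) := by
  have hlin (c c' : ℝ) : HasGaussianLaw (fun x : EuclideanSpace ℝ ι => c * x s + c' * x t)
      (multivariateGaussian 0 Q) :=
    (IsGaussian.hasGaussianLaw_id (μ := multivariateGaussian 0 Q)).map_fun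
      (c • EuclideanSpace.proj (𝕜 := ℝ) s + c' • EuclideanSpace.proj (𝕜 := ℝ) t)
  have hmean (c c' : ℝ) :
      ∫ x : EuclideanSpace ℝ ι, c * x s + c' * x t ∂(multivariateGaussian 0 Q) = 0 := by
    have := ContinuousLinearMap.integral_comp_id_comm (μ := multivariateGaussian 0 Q)
      IsGaussian.integrable_id
      (c • EuclideanSpace.proj (𝕜 := ℝ) s + c' • EuclideanSpace.proj (𝕜 := ℝ) t)
    simpa using this
  have hlaw (c c' : ℝ)
      (h : c * c * Q s s + c * c' * Q s t + c' * c * Q t s + c' * c' * Q t t = 1) :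
      (multivariateGaussian 0 Q).map (fun x => c * x s + c' * x t) = gaussianReal 0 1 := by
    rw [(hlin c c').map_eq_gaussianReal, hmean, ← covariance_self (by fun_prop),
      covariance_linear_multivariateGaussian hQ, h, Real.toNNReal_one]
  have hpair : HasGaussianLaw
      (fun x : EuclideanSpace ℝ ι => (a * x s + b * x t, a' * x s + b' * x t))
      (multivariateGaussian 0 Q) :=
    (IsGaussian.hasGaussianLaw_id (μ := multivariateGaussian 0 Q)).map_fun
      ((a • EuclideanSpace.proj (𝕜 := ℝ) s + b • EuclideanSpace.proj (𝕜 := ℝ) t).prod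
        (a' • EuclideanSpace.proj (𝕜 := ℝ) s + b' • EuclideanSpace.proj (𝕜 := ℝ) t))
  have hind := hpair.indepFun_of_covariance_eq_zero
    ((covariance_linear_multivariateGaussian hQ s t a b a' b').trans h₁₂)
  rw [(indepFun_iff_map_prod_eq_prod_map_map (by fun_prop) (by fun_prop)).1 hind, hlaw _ _ h₁,
    hlaw _ _ h₂]

/-- Sheppard's formula: the probability that two coordinates of a Gaussian vector have the same
sign. -/
theorem multivariateGaussian_sign_agree {d : ℕ} {Q : Matrix (Fin d) (Fin d) ℝ} (hQ : Q.PosDef)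
    {s t : Fin d} (h0 : 0 ≤ corr Q s t) (h1 : corr Q s t < 1) :
    (multivariateGaussian 0 Q).real {x | 0 ≤ x s ↔ 0 ≤ x t} =
      1 / 2 + Real.arcsin (corr Q s t) / Real.pi := by
  set ρ := corr Q s t with hρ
  have hs := Real.sqrt_pos.2 (hQ.diag_pos (i := s))
  have ht := Real.sqrt_pos.2 (hQ.diag_pos (i := t))
  have hss := Real.mul_self_sqrt (hQ.diag_pos (i := s)).le
  have htt := Real.mul_self_sqrt (hQ.diag_pos (i := t)).le
  have hc0 : 0 < 1 - ρ ^ 2 := by nlinarith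
  have hc := Real.sqrt_pos.2 hc0
  have hcc := Real.mul_self_sqrt hc0.le
  have hst : Q s t = ρ * (√(Q s s) * √(Q t t)) := by
    rw [hρ, corr, div_mul_cancel₀ _ (by positivity)]
  have hts : Q t s = ρ * (√(Q s s) * √(Q t t)) := by
    rw [← hst]; simpa using hQ.isHermitian.apply s t
  -- With `Z₁ = x s / σ_s` and `Z₂ = (x t / σ_t - ρ Z₁) / √(1 - ρ²)`, one has
  -- `x t / σ_t = ρ Z₁ + √(1 - ρ²) Z₂`.
  rw [← gaussianReal_prod_sign_agree h0 h1, ← map_multivariateGaussian_eq_prod hQ.posSemidef s t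
    (a := 1 / √(Q s s)) (b := 0) (a' := -ρ / (√(1 - ρ ^ 2) * √(Q s s)))
    (b' := 1 / (√(1 - ρ ^ 2) * √(Q t t)))]
  · rw [map_measureReal_apply (by fun_prop) (measurableSet_linear_sign_agree ρ)]
    congr 1
    ext x
    have e1 : 1 / √(Q s s) * x s + 0 * x t = (1 / √(Q s s)) * x s := by ring
    have e2 : ρ * (1 / √(Q s s) * x s) + √(1 - ρ ^ 2) *
        (-ρ / (√(1 - ρ ^ 2) * √(Q s s)) * x s + 1 / (√(1 - ρ ^ 2) * √(Q t t)) * x t) =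
        (1 / √(Q t t)) * x t := by
      field_simp
      ring
    simp only [Set.mem_ofPred_eq, Set.mem_preimage, e1, e2,
      mul_nonneg_iff_of_pos_left (one_div_pos.2 hs), mul_nonneg_iff_of_pos_left (one_div_pos.2 ht)]
  · field_simp
    linear_combination -hss
  · rw [hst, hts]
    generalize √(1 - ρ ^ 2) = c at *
    generalize √(Q s s) = σ at *
    generalize √(Q t t) = τ at *
    rw [← hss, ← htt]
    field_simp
    linear_combination -hcc
  · rw [hst]
    field_simp
    linear_combination ρ * √(Q t t) * hss

/-! ### Lower bounds by the gap, and the entropy -/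

/-- The function `x ↦ arcsin x - arcsin (β x)` is increasing on `[0, 1)`, so the smallest gap occurs
at the weakest correlation `α`. -/
theorem gap_le_arcsin_sub {α β x y : ℝ} (hα : 0 < α) (hβ0 : 0 < β) (hβ : β < 1) (hx : α ≤ x)
    (hx1 : x < 1) (hy : y ≤ β * x) :
    gap α β ≤ (Real.arcsin x - Real.arcsin y) / Real.pi := by
  have hmono : MonotoneOn (fun z => Real.arcsin z - Real.arcsin (z * β)) (Set.Ico 0 1) := by
    have hd : ∀ z ∈ Set.Ico (0 : ℝ) 1, HasDerivAt (fun z => Real.arcsin z - Real.arcsin (z * β))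
        (1 / √(1 - z ^ 2) - 1 / √(1 - (z * β) ^ 2) * β) z := by
      rintro z ⟨hz0, hz1⟩
      have hzβ : z * β < 1 := by nlinarith
      have hzβ0 : 0 ≤ z * β := by positivity
      have hcomp : HasDerivAt (fun z => Real.arcsin (z * β)) (1 / √(1 - (z * β) ^ 2) * β) z :=
        HasDerivAt.comp (h₂ := Real.arcsin) z
          (Real.hasDerivAt_arcsin (by linarith) hzβ.ne) (hasDerivAt_mul_const β)
      exact (Real.hasDerivAt_arcsin (by linarith) hz1.ne).sub hcomp
    refine monotoneOn_of_deriv_nonneg (convex_Ico 0 1)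
      (fun z hz => (hd z hz).continuousAt.continuousWithinAt) (fun z hz => ?_) (fun z hz => ?_)
    · exact (hd z (interior_subset hz)).differentiableAt.differentiableWithinAt
    · rw [(hd z (interior_subset hz)).deriv, sub_nonneg]
      obtain ⟨hz0, hz1⟩ := interior_subset hz
      have h1 : 0 < 1 - z ^ 2 := by nlinarith
      have h2 : z * β ≤ z := by nlinarith
      have h3 : 1 - z ^ 2 ≤ 1 - (z * β) ^ 2 := by
        have : 0 ≤ z * β := by positivity
        nlinarith
      calc 1 / √(1 - (z * β) ^ 2) * β ≤ 1 / √(1 - (z * β) ^ 2) :=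
            mul_le_of_le_one_right (by positivity) hβ.le
        _ ≤ 1 / √(1 - z ^ 2) :=
            one_div_le_one_div_of_le (Real.sqrt_pos.2 h1) (Real.sqrt_le_sqrt h3)
  have h1 := hmono ⟨hα.le, hx.trans_lt hx1⟩ ⟨hα.le.trans hx, hx1⟩ hx
  have h2 : Real.arcsin y ≤ Real.arcsin (x * β) := Real.monotone_arcsin (by linarith)
  have h3 := Real.pi_pos
  rw [gap, one_div, ← div_eq_inv_mul]
  refine div_le_div_of_nonneg_right ?_ h3.le
  simp only at h1
  linarith

theorem gap_le_arcsin_add {α β x y : ℝ} (hα : 0 < α) (hβ0 : 0 < β) (hx : α ≤ x) (hy : 0 ≤ y) :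
    gap α β ≤ (Real.arcsin x + Real.arcsin y) / Real.pi := by
  have h1 := Real.monotone_arcsin hx
  have h2 := Real.arcsin_nonneg.2 hy
  have h3 := Real.arcsin_nonneg.2 (mul_pos hα hβ0).le
  rw [gap, one_div, ← div_eq_inv_mul]
  exact div_le_div_of_nonneg_right (by linarith) Real.pi_pos.le

theorem gap_nonneg {α β : ℝ} (hα : 0 < α) (hβ : β < 1) : 0 ≤ gap α β := by
  have : Real.arcsin (α * β) ≤ Real.arcsin α := Real.monotone_arcsin (by nlinarith)
  rw [gap]
  exact mul_nonneg (by positivity) (by linarith)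

/-- The information `1 - H` grows with the distance to `1 / 2`; `h₁` and `h₂` say that `x` is
above `1 / 2` and further from it than `y` is. -/
theorem one_sub_binEntropy_lt {x y : ℝ} (hx1 : x ≤ 1) (h₁ : y < x)
    (h₂ : 1 - y < x) :
    1 - Real.binEntropy y / Real.log 2 < 1 - Real.binEntropy x / Real.log 2 := by
  have hlog : 0 < Real.log 2 := Real.log_pos one_lt_two
  refine sub_lt_sub_left (div_lt_div_of_pos_right ?_ hlog) 1
  rcases le_or_gt 2⁻¹ y with hy | hy
  · exact Real.binEntropy_strictAntiOn ⟨hy, h₁.le.trans hx1⟩ ⟨hy.trans h₁.le, hx1⟩ h₁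
  · rw [← Real.binEntropy_one_sub y]
    have : (2⁻¹ : ℝ) ≤ 1 - y := by norm_num at hy ⊢; linarith
    exact Real.binEntropy_strictAntiOn ⟨this, by linarith⟩ ⟨this.trans h₂.le, hx1⟩ h₂

/-! ### Concentration and the union bound -/

/-- Hoeffding's inequality for the sum of a `[-1, 1]`-valued statistic with mean at least `g`. -/
theorem measureReal_sum_comp_nonpos_le {Ω E : Type*} [MeasurableSpace Ω] [MeasurableSpace E]
    {P : Measure Ω} [IsProbabilityMeasure P] {μ : Measure E} {n : ℕ} {X : Fin n → Ω → E}
    (hlaw : ∀ i, HasLaw (X i) μ P) (hindep : iIndepFun X P) {f : E → ℝ} (hf : Measurable f)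
    (hf1 : ∀ x, f x ∈ Set.Icc (-1 : ℝ) 1) {g : ℝ} (hg : 0 ≤ g) (hgf : g ≤ ∫ x, f x ∂μ) :
    P.real {ω | ∑ i, f (X i ω) ≤ 0} ≤ Real.exp (-(1 / 2) * n * g ^ 2) := by
  have hmean (i : Fin n) : ∫ ω, -f (X i ω) ∂P = -∫ x, f x ∂μ := by
    rw [integral_neg, ← (hlaw i).integral_comp hf.aestronglyMeasurable]
    rfl
  have hsub (i : Fin n) : HasSubgaussianMGF (fun ω => -f (X i ω) - ∫ ω, -f (X i ω) ∂P) 1 P := by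
    have := hasSubgaussianMGF_of_mem_Icc (μ := P) (X := fun ω => -f (X i ω)) (a := -1) (b := 1)
      ((hf.comp_aemeasurable (hlaw i).aemeasurable).neg)
      (.of_forall fun ω => ⟨neg_le_neg (hf1 _).2, by linarith [(hf1 (X i ω)).1]⟩)
    convert this using 1
    ext
    norm_num
  have hind : iIndepFun (fun i ω => -f (X i ω) - ∫ ω, -f (X i ω) ∂P) P :=
    hindep.comp (fun i x => -f x - ∫ ω, -f (X i ω) ∂P) fun i => hf.neg.sub_const _
  have h := HasSubgaussianMGF.measure_sum_ge_le_of_iIndepFun hind (c := fun _ => 1)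
    (s := Finset.univ) (fun i _ => hsub i) (ε := n * g) (by positivity)
  refine (measureReal_mono fun ω hω => ?_).trans (h.trans_eq ?_)
  · have hω : ∑ i, f (X i ω) ≤ 0 := hω
    simp only [Set.mem_ofPred_eq, hmean, Finset.sum_sub_distrib, Finset.sum_neg_distrib,
      Finset.sum_const, Finset.card_univ, Fintype.card_fin, nsmul_eq_mul]
    have := mul_le_mul_of_nonneg_left hgf (Nat.cast_nonneg (α := ℝ) n)
    linarith
  · congr 1
    rcases Nat.eq_zero_or_pos n with rfl | hn
    · simp
    · have : (0 : ℝ) < n := by exact_mod_cast hn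
      simp
      field_simp

/-- The indicator that coordinates `j` and `k` of `x` have the same sign. -/
noncomputable def signAgree {d : ℕ} (j k : Fin d) (x : EuclideanSpace ℝ (Fin d)) : ℝ :=
  {x : EuclideanSpace ℝ (Fin d) | 0 ≤ x j ↔ 0 ≤ x k}.indicator 1 x

theorem measurableSet_signAgree {d : ℕ} (j k : Fin d) :
    MeasurableSet {x : EuclideanSpace ℝ (Fin d) | 0 ≤ x j ↔ 0 ≤ x k} := by
  have (i : Fin d) : MeasurableSet {x : EuclideanSpace ℝ (Fin d) | 0 ≤ x i} :=
    measurableSet_le measurable_const (by fun_prop)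
  exact (this j).iff (this k)

theorem measurable_signAgree {d : ℕ} (j k : Fin d) : Measurable (signAgree j k) :=
  measurable_one.indicator (measurableSet_signAgree j k)

theorem signAgree_mem_Icc {d : ℕ} (j k : Fin d) (x : EuclideanSpace ℝ (Fin d)) :
    signAgree j k x ∈ Set.Icc (0 : ℝ) 1 :=
  ⟨Set.indicator_nonneg (by simp) _, Set.indicator_le_self' (by simp) _⟩

theorem integrable_signAgree {d : ℕ} (j k : Fin d) (μ : Measure (EuclideanSpace ℝ (Fin d)))
    [IsProbabilityMeasure μ] : Integrable (signAgree j k) μ :=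
  Integrable.of_mem_Icc 0 1 (measurable_signAgree j k).aemeasurable
    (.of_forall (signAgree_mem_Icc j k))

theorem integral_signAgree {d : ℕ} {Q : Matrix (Fin d) (Fin d) ℝ} (hQ : Q.PosDef)
    {s t : Fin d} (h0 : 0 ≤ corr Q s t) (h1 : corr Q s t < 1) :
    ∫ x, signAgree s t x ∂(multivariateGaussian 0 Q) =
      1 / 2 + Real.arcsin (corr Q s t) / Real.pi :=
  (integral_indicator_one (measurableSet_signAgree s t)).trans
    (multivariateGaussian_sign_agree hQ h0 h1)

theorem signVec_mul_eq_one_iff {d : ℕ} (x : EuclideanSpace ℝ (Fin d)) (j k : Fin d) :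
    signVec x j * signVec x k = 1 ↔ (0 ≤ x j ↔ 0 ≤ x k) := by
  by_cases hj : 0 ≤ x j <;> by_cases hk : 0 ≤ x k <;> simp [signVec, hj, hk]

/-- Multiplying by `n` avoids division by zero: both sides vanish when `n = 0`. -/
theorem mul_thetaHat_signVec {d n : ℕ} (x : Fin n → EuclideanSpace ℝ (Fin d)) (j k : Fin d) :
    n * thetaHat (fun i => signVec (x i)) s(j, k) = ∑ i, signAgree j k (x i) := by
  have h : thetaHat (fun i => signVec (x i)) s(j, k) = 1 / (n : ℝ) * ∑ i, signAgree j k (x i) := by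
    simp only [thetaHat, Sym2.lift_mk, signVec_mul_eq_one_iff, signAgree, Set.indicator,
      Set.mem_ofPred_eq, Pi.one_apply]
  rw [h]
  rcases Nat.eq_zero_or_pos n with rfl | hn
  · simp
  · field_simp

theorem thetaHat_le_one {d n : ℕ} (u : Fin n → Fin d → ℤ) (e : Sym2 (Fin d)) :
    thetaHat u e ≤ 1 := by
  induction e using Sym2.ind with
  | _ j k =>
  have h : ∑ i : Fin n, (if u i j * u i k = 1 then (1 : ℝ) else 0) ≤ n := by
    refine (Finset.sum_le_card_nsmul _ _ 1 fun i _ => ?_).trans (by simp)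
    split_ifs <;> norm_num
  simp only [thetaHat, Sym2.lift_mk]
  rcases Nat.eq_zero_or_pos n with rfl | hn
  · simp
  · rw [one_div, inv_mul_le_iff₀ (by positivity), mul_one]
    exact h

/-- `OnPath T e f`: the tree edge `e` lies on the path joining the ends of the non-edge `f`. -/
def OnPath {V : Type*} (T : SimpleGraph V) (e f : Sym2 V) : Prop :=
  ∃ (s t : V) (p : T.Walk s t), p.IsPath ∧ s ≠ t ∧ ¬ T.Adj s t ∧ e ∈ p.edges ∧ f = s(s, t)

theorem IsTreeGGM.gap_le_integral_of_mem_edges {d : ℕ} {T : SimpleGraph (Fin d)}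
    {Q : Matrix (Fin d) (Fin d) ℝ}
    (h : IsTreeGGM T Q) {α β : ℝ} (hα : 0 < α) (hβ0 : 0 < β) (hβ : β < 1)
    (hcorr : ∀ j k, T.Adj j k → α ≤ corr Q j k ∧ corr Q j k ≤ β) {s t : Fin d} (p : T.Walk s t)
    (hp : p.IsPath) (hst : s ≠ t) (hadj : ¬ T.Adj s t) {j k : Fin d} (he : s(j, k) ∈ p.edges) :
    gap α β ≤ ∫ x, (signAgree j k x - signAgree s t x) ∂(multivariateGaussian 0 Q) ∧
    gap α β ≤ ∫ x, (signAgree j k x + signAgree s t x - 1) ∂(multivariateGaussian 0 Q) := by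
  have hlen : 2 ≤ p.length := by
    have h0 : p.length ≠ 0 := fun h => hst (SimpleGraph.Walk.eq_of_length_eq_zero h)
    have h1 : p.length ≠ 1 := fun h => hadj (SimpleGraph.Walk.adj_of_length_eq_one h)
    omega
  obtain ⟨hst0, -, hstβ⟩ := h.corr_bounds_of_isPath hα hβ hcorr p hp
  have hle := (h.corr_le_of_mem_edges hα hβ hcorr p hp he).2 hlen
  obtain ⟨hjα, hjβ⟩ := hcorr j k (p.adj_of_mem_edges he)
  have hst1 : corr Q s t < 1 := (hstβ (by omega)).trans_lt hβ
  have hi := fun i i' : Fin d => integrable_signAgree i i' (multivariateGaussian 0 Q)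
  have hjk := integral_signAgree h.posDef (hα.le.trans hjα) (hjβ.trans_lt hβ)
  have hst' := integral_signAgree h.posDef hst0.le hst1
  constructor
  · rw [integral_sub (hi _ _) (hi _ _), hjk, hst', add_sub_add_left_eq_sub, ← sub_div]
    exact gap_le_arcsin_sub hα hβ0 hβ hjα (hjβ.trans_lt hβ) hle
  · have hadd : Integrable (fun x => signAgree j k x + signAgree s t x)
      (multivariateGaussian 0 Q) := (hi j k).add (hi s t)
    rw [integral_sub hadd (integrable_const _), integral_add (hi _ _) (hi _ _), hjk, hst']
    simp only [integral_const, probReal_univ, smul_eq_mul, one_mul]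
    refine (gap_le_arcsin_add hα hβ0 hjα hst0.le).trans_eq ?_
    ring

/-- The pair `f` is likely to be less informative than an edge `e` on its path. The event
`θ_e ≤ 1 - θ_f` matters only for the entropy weights, which are symmetric under `θ ↦ 1 - θ`. -/
theorem IsTreeGGM.measureReal_thetaHat_le {Ω : Type*} [MeasurableSpace Ω] {P : Measure Ω}
    [IsProbabilityMeasure P] {d n : ℕ} {T : SimpleGraph (Fin d)} {Q : Matrix (Fin d) (Fin d) ℝ}
    (h : IsTreeGGM T Q) {α β : ℝ} (hα : 0 < α) (hβ0 : 0 < β) (hβ : β < 1)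
    (hcorr : ∀ j k, T.Adj j k → α ≤ corr Q j k ∧ corr Q j k ≤ β)
    {X : Fin n → Ω → EuclideanSpace ℝ (Fin d)}
    (hlaw : ∀ i : Fin n, HasLaw (X i) (multivariateGaussian 0 Q) P) (hindep : iIndepFun X P)
    {e f : Sym2 (Fin d)} (hef : OnPath T e f) :
    P.real {ω | thetaHat (fun i => signVec (X i ω)) e ≤ thetaHat (fun i => signVec (X i ω)) f ∨
      thetaHat (fun i => signVec (X i ω)) e ≤ 1 - thetaHat (fun i => signVec (X i ω)) f} ≤
      2 * Real.exp (-(1 / 2) * n * gap α β ^ 2) := by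
  obtain ⟨s, t, p, hp, hst, hadj, he, rfl⟩ := hef
  induction e using Sym2.ind with
  | _ j k =>
  obtain ⟨h1, h2⟩ := h.gap_le_integral_of_mem_edges hα hβ0 hβ hcorr p hp hst hadj he
  have hg := gap_nonneg hα hβ
  have hI := fun (i i' : Fin d) x => signAgree_mem_Icc i i' x
  have b1 := measureReal_sum_comp_nonpos_le hlaw hindep
    ((measurable_signAgree j k).sub (measurable_signAgree s t))
    (fun x => ⟨by simp only [Pi.sub_apply]; linarith [(hI j k x).1, (hI s t x).2],
      by simp only [Pi.sub_apply]; linarith [(hI j k x).2, (hI s t x).1]⟩) hg h1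
  have b2 := measureReal_sum_comp_nonpos_le hlaw hindep
    (((measurable_signAgree j k).add (measurable_signAgree s t)).sub_const 1)
    (fun x => ⟨by simp only [Pi.add_apply]; linarith [(hI j k x).1, (hI s t x).1],
      by simp only [Pi.add_apply]; linarith [(hI j k x).2, (hI s t x).2]⟩) hg h2
  rw [two_mul]
  refine (measureReal_mono ?_).trans ((measureReal_union_le _ _).trans (add_le_add b1 b2))
  rintro ω (hω | hω)
  · left
    have := mul_le_mul_of_nonneg_left hω (Nat.cast_nonneg (α := ℝ) n)
    rw [mul_thetaHat_signVec, mul_thetaHat_signVec] at this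
    simpa [Finset.sum_sub_distrib] using this
  · right
    have := mul_le_mul_of_nonneg_left hω (Nat.cast_nonneg (α := ℝ) n)
    rw [mul_sub, mul_thetaHat_signVec, mul_thetaHat_signVec, mul_one] at this
    simp only [Set.mem_ofPred_eq, Pi.add_apply, Finset.sum_sub_distrib, Finset.sum_add_distrib,
      Finset.sum_const, Finset.card_univ, Fintype.card_fin, nsmul_eq_mul, mul_one]
    linarith

open Classical in
/-- There are at most `(d - 1) * d.choose 2 ≤ d ^ 3 / 2` pairs of a tree edge and a non-edge. -/
theorem card_onPath_le {V : Type*} [Fintype V] {T : SimpleGraph V} (hT : T.IsTree) :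
    (((Finset.univ : Finset (Sym2 V × Sym2 V)).filter fun q => OnPath T q.1 q.2).card : ℝ) * 2 ≤
      (Fintype.card V : ℝ) ^ 3 := by
  have hsub : ((Finset.univ : Finset (Sym2 V × Sym2 V)).filter fun q => OnPath T q.1 q.2) ⊆
      T.edgeFinset ×ˢ (Finset.univ.filter fun f : Sym2 V => ¬ f.IsDiag) := by
    rintro ⟨e, f⟩ hq
    obtain ⟨s, t, p, -, hst, -, he, rfl⟩ := (Finset.mem_filter.1 hq).2
    simpa [hst] using p.edges_subset_edgeSet he
  have hcard := Finset.card_le_card hsub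
  rw [Finset.card_product, ← Fintype.card_subtype (fun f : Sym2 V => ¬ f.IsDiag),
    Sym2.card_subtype_not_diag] at hcard
  have h1 : T.edgeFinset.card ≤ Fintype.card V := by
    have := hT.card_edgeFinset
    omega
  have h2 : (((Fintype.card V).choose 2 : ℕ) : ℝ) ≤ (Fintype.card V : ℝ) ^ 2 / 2 := by
    simpa using Nat.choose_le_pow_div (α := ℝ) 2 (Fintype.card V)
  have h3 := (Nat.cast_le (α := ℝ)).2 (hcard.trans (Nat.mul_le_mul_right _ h1))
  rw [Nat.cast_mul] at h3
  have h4 := mul_le_mul_of_nonneg_left h2 (Nat.cast_nonneg (α := ℝ) (Fintype.card V))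
  linarith

/-- The error bound for any edge weights `w` under which `e` outweighs `f` whenever `θ_e` exceeds
both `θ_f` and `1 - θ_f`. The error event need not be measurable. -/
theorem IsTreeGGM.measureReal_ne_le {Ω : Type*} [MeasurableSpace Ω] {P : Measure Ω}
    [IsProbabilityMeasure P] {d n : ℕ} {T : SimpleGraph (Fin d)} {Q : Matrix (Fin d) (Fin d) ℝ}
    (h : IsTreeGGM T Q) {α β : ℝ} (hα : 0 < α) (hβ0 : 0 < β) (hβ : β < 1)
    (hcorr : ∀ j k, T.Adj j k → α ≤ corr Q j k ∧ corr Q j k ≤ β)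
    {X : Fin n → Ω → EuclideanSpace ℝ (Fin d)}
    (hlaw : ∀ i : Fin n, HasLaw (X i) (multivariateGaussian 0 Q) P) (hindep : iIndepFun X P)
    {w : Ω → Sym2 (Fin d) → ℝ}
    (hw : ∀ ω e f, thetaHat (fun i => signVec (X i ω)) f < thetaHat (fun i => signVec (X i ω)) e →
      1 - thetaHat (fun i => signVec (X i ω)) f < thetaHat (fun i => signVec (X i ω)) e →
      w ω f < w ω e)
    {That : Ω → SimpleGraph (Fin d)} (hThat : ∀ ω, IsKruskalOutput (w ω) (That ω)) :
    P.real {ω | That ω ≠ T} ≤ (d : ℝ) ^ 3 * Real.exp (-(1 / 2) * n * gap α β ^ 2) := by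
  classical
  have hsub : {ω | That ω ≠ T} ⊆
      ⋃ q ∈ (Finset.univ : Finset (Sym2 (Fin d) × Sym2 (Fin d))).filter
        fun q => OnPath T q.1 q.2,
      {ω | thetaHat (fun i => signVec (X i ω)) q.1 ≤ thetaHat (fun i => signVec (X i ω)) q.2 ∨
        thetaHat (fun i => signVec (X i ω)) q.1 ≤
          1 - thetaHat (fun i => signVec (X i ω)) q.2} := by
    intro ω hω
    by_contra hcon
    refine hω (IsKruskalOutput.eq_of_forall_path_lt h.isTree ?_ (hThat ω))
    intro s t p hp hst hadj e he
    simp only [Set.mem_iUnion, not_exists] at hcon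
    have := hcon (e, s(s, t)) 
      (Finset.mem_filter.2 ⟨Finset.mem_univ _, s, t, p, hp, hst, hadj, he, rfl⟩)
    simp only [Set.mem_ofPred_eq, not_or, not_le] at this
    exact hw ω e _ this.1 this.2
  refine (measureReal_mono hsub (measure_ne_top _ _)).trans ((measureReal_biUnion_finset_le _ _).trans ?_)
  refine (Finset.sum_le_card_nsmul _ _ _ fun q hq => h.measureReal_thetaHat_le hα hβ0 hβ hcorr
    hlaw hindep (Finset.mem_filter.1 hq).2).trans ?_
  rw [nsmul_eq_mul, ← mul_assoc]
  refine mul_le_mul_of_nonneg_right ?_ (Real.exp_nonneg _)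
  simpa using card_onPath_le h.isTree

end SignTree

theorem theorem1 {Ω : Type*} [MeasurableSpace Ω] (P : Measure Ω) [IsProbabilityMeasure P]
    (d n : ℕ) (T : SimpleGraph (Fin d)) (Q : Matrix (Fin d) (Fin d) ℝ)
    (hTQ : SignTree.IsTreeGGM T Q)
    (α β : ℝ) (hα : 0 < α) (hαβ : α < β) (hβ : β < 1)
    (hcorr : ∀ j k : Fin d, T.Adj j k → α ≤ SignTree.corr Q j k ∧ SignTree.corr Q j k ≤ β)
    (X : Fin n → Ω → EuclideanSpace ℝ (Fin d))
    (hlaw : ∀ i : Fin n, HasLaw (X i) (multivariateGaussian 0 Q) P)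
    (hindep : iIndepFun X P) :
    (∀ That : Ω → SimpleGraph (Fin d),
      (∀ ω : Ω, SignTree.IsKruskalOutput
        (SignTree.mutualInfoHat (fun i => SignTree.signVec (X i ω))) (That ω)) →
      P.real {ω | That ω ≠ T} ≤
        (d : ℝ) ^ 3 * Real.exp (-(1 / 2) * n * (SignTree.gap α β) ^ 2)) ∧
    (∀ That : Ω → SimpleGraph (Fin d),
      (∀ ω : Ω, SignTree.IsKruskalOutput
        (SignTree.thetaHat (fun i => SignTree.signVec (X i ω))) (That ω)) →
      P.real {ω | That ω ≠ T} ≤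
        (d : ℝ) ^ 3 * Real.exp (-(1 / 2) * n * (SignTree.gap α β) ^ 2)) := by
  have hβ0 : 0 < β := hα.trans hαβ
  refine ⟨fun That hThat => ?_, fun That hThat => ?_⟩
  · exact hTQ.measureReal_ne_le hα hβ0 hβ hcorr hlaw hindep
      (fun ω e f h₁ h₂ => SignTree.one_sub_binEntropy_lt (SignTree.thetaHat_le_one _ _) h₁ h₂) hThat
  · exact hTQ.measureReal_ne_le hα hβ0 hβ hcorr hlaw hindep (fun ω e f h₁ _ => h₁) hThat
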